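/- Let $p$ be an odd prime, let $m,u$ be positive integers, $q=p^m$, $v=\gcd(m,u)$ and $s=m/2$, and let $\mathrm{Tr}$ be the trace function from $\mathbb{F}_q$ to $\mathbb{F}_p$. Put $$D_1=\{(x,y)\in\mathbb{F}_q^2\setminus\{(0,0)\} : \mathrm{Tr}(x+y^{p^u+1})=0\}$$ and $$C_{D_1}=\{(\mathrm{Tr}(ax+by))_{(x,y)\in D_1} : a,b\in\mathbb{F}_q\}.$$ If $m/v\equiv 0\pmod 4$, then $C_{D_1}$ is a linear code over $\mathbb{F}_p$ of length $p^{2m-1}-1$ and dimension $2m$, and exactly three nonzero Hamming weights occur among its codewords. Writing $A_w$ for the number of codewords of Hamming weight $w$, we have $A_0=1$ and, with $$w_1=(p-1)p^{2m-2},\quad w_2=(p-1)p^{2m-2}\left(1+\frac{1}{p^{s-v}}\right),\quad w_3=(p-1)p^{2m-2}\left(1-\frac{1}{(p-1)p^{s-v}}\right),$$ $$A_{w_1}=p^{2m}-1-(p-1)p^{m-2v},$$ $$A_{w_2}=(p-1)\left(p^{m-2v-1}-p^{s-v}+p^{s-v-1}\right),$$ $$A_{w_3}=(p-1)\left(p^{s-v}+1\right)\left(p^{s-v}-p^{s-v-1}\right),$$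 and $A_w=0$ for every other $w$. -/

import Mathlib

namespace LinCode

section Codes

variable {K : Type*} [Field K] [DecidableEq K] {ι : Type*} [Fintype ι]

/-- An `[n, k]` linear code over `K`: a `k`-dimensional subspace of the space of words whose
coordinates are indexed by `n` positions. -/
def IsCode (C : Submodule K (ι → K)) (n k : ℕ) : Prop :=
  Fintype.card ι = n ∧ Module.finrank K C = k

/-- `A C i` is the number of codewords of `C` of Hamming weight `i`. -/
noncomputable def A (C : Submodule K (ι → K)) (i : ℕ) : ℕ :=
  Set.ncard {c : ι → K | c ∈ C ∧ hammingNorm c = i}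

/-- `C` is a `t`-weight code: exactly `t` of the numbers `A_1, …, A_n` are nonzero. -/
def IsWeightCode (t : ℕ) (C : Submodule K (ι → K)) : Prop :=
  Set.ncard {i : ℕ | 1 ≤ i ∧ i ≤ Fintype.card ι ∧ A C i ≠ 0} = t

end Codes

section DefiningSet

variable (p : ℕ) [Fact p.Prime] {F : Type*} [Field F] [Algebra (ZMod p) F]

/-- The map `(a, b) ↦ c(a, b) = (Tr(ax + by))_{(x, y) ∈ D}`. -/
noncomputable def codeword (D : Finset (F × F)) : F × F →ₗ[ZMod p] (D → ZMod p) where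
  toFun ab d := Algebra.trace (ZMod p) F (ab.1 * d.1.1 + ab.2 * d.1.2)
  map_add' ab ab' := by
    funext d
    simp only [Prod.fst_add, Prod.snd_add, Pi.add_apply, ← map_add]
    congr 1
    ring
  map_smul' r ab := by
    funext d
    simp only [Prod.smul_fst, Prod.smul_snd, Pi.smul_apply, RingHom.id_apply, ← map_smul,
      smul_add, smul_mul_assoc]

/-- The code `C_D = {c(a, b) : a, b ∈ F}` with defining set `D ⊆ F²`. -/
noncomputable def code (D : Finset (F × F)) : Submodule (ZMod p) (D → ZMod p) :=
  LinearMap.range (codeword p D)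

variable (F)

/-- The defining set `D₁ = {(x, y) ∈ F² \ {(0,0)} : Tr(x + y^(p^u + 1)) = 0}`. -/
noncomputable def D₁ [Fintype F] [DecidableEq F] (u : ℕ) : Finset (F × F) :=
  Finset.univ.filter fun z =>
    z ≠ (0, 0) ∧ Algebra.trace (ZMod p) F (z.1 + z.2 ^ (p ^ u + 1)) = 0

end DefiningSet

end LinCode

/-! Put Q(y) = Tr(y^(p^u+1)), a quadratic form over 𝔽_p with polar form B, so that D₁ with the
origin restored is the zero set of Tr(x) + Q(y). The weight of c(a,b) measures how the hyperplane
Tr(ax+by) = 0 cuts this set. If a ∉ 𝔽_p, or if a = 0 ≠ b, the cut has exactly the proportion 1/p. If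
a = α ∈ 𝔽_p^*, substituting Tr(x) = -Q(y) leaves the equation Q(y) = α⁻¹Tr(by). It is again balanced
when the functional on the right is not of the form B(x,·); otherwise completing the square turns it
into Q(y) = Q(x), and only the size of a level set of Q matters.

No character sums are needed for the level sets. Every element of 𝔽_p^* is a (p^u+1)-th power, so
all nonzero levels have one size N (`card_goldForm_eq`). Counting pairs with Q(y) = Q(y') gives
(Z-N)² = |rad B|·q for the zero level size Z (`sq_card_sub_card`), and the radical has p^(2v)
elements (`card_pow_add_self_eq_zero`). The sign of Z-N follows from p^v+1 ∣ N
(`dvd_card_goldForm_eq`). Since Q is constant on cosets of the radical, the level sizes also give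
the frequencies of w₂ and w₃ (`card_represented`); the total p^(2m) gives that of w₁. -/

namespace LinCode

/-! ### Equidistribution by translation -/

section Averaging

variable {K V : Type*} [Field K] [AddCommGroup V] [Module K V]

/-- A set of vectors stable under translation along `e` is equidistributed among the level sets
of a function which is affine of slope one along `e`. -/
theorem card_mul_card_level (P : V → Prop) (l : V → K) (e : V)
    (hP : ∀ x (t : K), P x → P (x + t • e)) (hl : ∀ x (t : K), l (x + t • e) = l x + t) (c : K) :
    Nat.card K * Nat.card {x // P x ∧ l x = c} = Nat.card {x // P x} := by
  rw [← Nat.card_prod]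
  refine Nat.card_congr
    { toFun := fun z => ⟨z.2.1 + z.1 • e, hP _ _ z.2.2.1⟩
      invFun := fun x => (l x.1 - c, ⟨x.1 + (-(l x.1 - c)) • e, hP _ _ x.2, by rw [hl]; ring⟩)
      left_inv := ?_
      right_inv := ?_ }
  · rintro ⟨t, x, hx, hc⟩
    have : l (x + t • e) - c = t := by rw [hl, hc]; ring
    ext
    · exact this
    · simp only [this]
      module
  · rintro ⟨x, hx⟩
    ext
    simp only
    module

end Averaging

/-! ### Functions with equally large nonzero levels -/

section LevelCounting

variable {K V : Type*} [Finite K] [Zero K] [Finite V]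

theorem card_pairs_eq (f : V → K) (N : ℕ) (hN : ∀ t ≠ 0, Nat.card {x // f x = t} = N) :
    Nat.card {z : V × V // f z.1 = f z.2} =
      Nat.card {x // f x = 0} ^ 2 + (Nat.card K - 1) * N ^ 2 := by
  classical
  have := Fintype.ofFinite K
  let e : {z : V × V // f z.1 = f z.2} ≃ Σ t : K, {x // f x = t} × {x // f x = t} :=
    { toFun := fun z => ⟨f z.1.2, ⟨z.1.1, z.2⟩, ⟨z.1.2, rfl⟩⟩
      invFun := fun z => ⟨(z.2.1.1, z.2.2.1), z.2.1.2.trans z.2.2.2.symm⟩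
      left_inv := fun z => rfl
      right_inv := by rintro ⟨t, ⟨x, hx⟩, ⟨y, rfl⟩⟩; rfl }
  rw [Nat.card_congr e, Nat.card_sigma, ← Finset.add_sum_erase _ _ (Finset.mem_univ (0 : K)),
    Finset.sum_congr rfl (g := fun _ => N ^ 2)]
  · simp [Nat.card_prod, sq, Finset.card_erase_of_mem]
  · intro t ht
    rw [Nat.card_prod, hN t (Finset.ne_of_mem_erase ht), sq]

theorem card_eq_add (f : V → K) (N : ℕ) (hN : ∀ t ≠ 0, Nat.card {x // f x = t} = N) :
    Nat.card V = Nat.card {x // f x = 0} + (Nat.card K - 1) * N := by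
  classical
  have := Fintype.ofFinite K
  rw [← Nat.card_congr (Equiv.sigmaFiberEquiv f), Nat.card_sigma,
    ← Finset.add_sum_erase _ _ (Finset.mem_univ (0 : K)), Finset.sum_congr rfl (g := fun _ => N)]
  · simp [Finset.card_erase_of_mem]
  · intro t ht
    exact hN t (Finset.ne_of_mem_erase ht)

end LevelCounting

/-! ### Counting with quadratic forms over a field -/

section QuadraticCounting

variable {K V : Type*} [Field K] [AddCommGroup V] [Module K V]

/-- A linear functional which does not vanish identically takes each value equally often. -/
theorem card_mul_card_add_eq_zero (l : V →ₗ[K] K) (hl : l ≠ 0) (c : K) :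
    Nat.card K * Nat.card {y // l y = c} = Nat.card V := by
  obtain ⟨e, he⟩ : ∃ e, l e = 1 := LinearMap.surjective hl 1
  have := card_mul_card_level (fun _ : V => True) l e (by simp) (by simp [he]) c
  simpa using this

variable {f : V → K} {B : V →ₗ[K] V →ₗ[K] K}

theorem eq_zero_of_mem_ker (h2 : (2 : K) ≠ 0) (hB : ∀ x, B x x = 2 * f x) {r : V}
    (hr : r ∈ LinearMap.ker B) : f r = 0 := by
  have := hB r
  rw [LinearMap.mem_ker.1 hr] at this
  simpa [h2] using this.symm

/-- With h = x - y, the condition f(h+y) = f(y) becomes B(h,y) = -f(h), which is affine in y. It is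
void for h in the radical, where f vanishes, and otherwise holds for one y in |K|. Terms are placed
so that no natural subtraction occurs. -/
theorem card_mul_card_pairs [Finite V] (h2 : (2 : K) ≠ 0) (hB : ∀ x, B x x = 2 * f x)
    (hf : ∀ x y, f (x + y) = f x + f y + B x y) :
    Nat.card K * Nat.card {z : V × V // f z.1 = f z.2} + Nat.card (LinearMap.ker B) * Nat.card V =
      Nat.card K * (Nat.card (LinearMap.ker B) * Nat.card V) + Nat.card V * Nat.card V := by
  classical
  have := Fintype.ofFinite V
  let e : {z : V × V // f z.1 = f z.2} ≃ Σ h : V, {y // B h y = - f h} :=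
    { toFun := fun z => ⟨z.1.1 - z.1.2, z.1.2, by
        have := hf (z.1.1 - z.1.2) z.1.2
        rw [sub_add_cancel, z.2] at this
        linear_combination -this⟩
      invFun := fun z => ⟨(z.1 + z.2.1, z.2.1), by
        have := z.2.2
        simp only [hf]
        linear_combination this⟩
      left_inv := fun z => by ext <;> simp
      right_inv := by
        rintro ⟨h, y, hy⟩
        have h1 : h + y - y = h := by abel
        simp only [Sigma.mk.injEq]
        refine ⟨h1, ?_⟩
        congr! 3 <;> rw [h1] }
  rw [Nat.card_congr e, Nat.card_sigma]
  have key : ∀ h : V, Nat.card K * Nat.card {y // B h y = - f h} +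
      (if h ∈ LinearMap.ker B then Nat.card V else 0) =
      Nat.card K * (if h ∈ LinearMap.ker B then Nat.card V else 0) + Nat.card V := by
    intro h
    split_ifs with hh
    · congr 2
      rw [eq_zero_of_mem_ker h2 hB hh, LinearMap.mem_ker.1 hh]
      simp
    · rw [card_mul_card_add_eq_zero (B h) (by simpa using hh)]
      simp
  have hs : ∑ h : V, (if h ∈ LinearMap.ker B then Nat.card V else 0) =
      Nat.card (LinearMap.ker B) * Nat.card V := by
    rw [← Finset.sum_filter, Finset.sum_const, smul_eq_mul, Nat.card_eq_fintype_card (α := LinearMap.ker B),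
      Fintype.card_subtype]
  have := Finset.sum_congr (rfl : (Finset.univ : Finset V) = Finset.univ) fun h _ => key h
  rw [Finset.sum_add_distrib, Finset.sum_add_distrib, ← Finset.mul_sum, ← Finset.mul_sum, hs] at this
  rw [this]
  simp

/-- If a quadratic form takes all nonzero values equally often, the excess of its zeros is up to
sign the square root of the number of vectors times the size of the radical. -/
theorem sq_card_sub_card [Finite K] [Finite V] (h2 : (2 : K) ≠ 0) (hB : ∀ x, B x x = 2 * f x)
    (hf : ∀ x y, f (x + y) = f x + f y + B x y)
    (N : ℕ) (hN : ∀ t ≠ 0, Nat.card {x // f x = t} = N) :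
    ((Nat.card {x // f x = 0} : ℤ) - N) ^ 2 = Nat.card (LinearMap.ker B) * Nat.card V := by
  have e1 := card_mul_card_pairs h2 hB hf
  rw [card_pairs_eq f N hN] at e1
  have e2 := card_eq_add f N hN
  have hK : 1 < Nat.card K := Finite.one_lt_card
  obtain ⟨k, hk⟩ : ∃ k, Nat.card K = k + 1 := ⟨Nat.card K - 1, by omega⟩
  have hk0 : (k : ℤ) ≠ 0 := by
    have : 0 < k := by omega
    positivity
  rw [hk, Nat.add_sub_cancel] at e1 e2
  generalize Nat.card {x // f x = 0} = Z at *
  generalize Nat.card (LinearMap.ker B) = R at *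
  generalize Nat.card V = q at *
  zify at e1 e2
  -- Substituting q = Z + kN, the pair count becomes k(Z-N)² = kRq.
  apply mul_left_cancel₀ hk0
  rw [e2] at e1 ⊢
  linear_combination e1

/-- Functionals outside the image of the polar form. -/
theorem card_mul_card_eq_of_not_mem_range [Finite V] (h2 : (2 : K) ≠ 0) (hB : ∀ x, B x x = 2 * f x)
    (hf : ∀ x y, f (x + y) = f x + f y + B x y) (hs : ∀ x y, B x y = B y x)
    (l : V →ₗ[K] K) (hl : l ∉ LinearMap.range B) :
    Nat.card K * Nat.card {y // f y = l y} = Nat.card V := by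
  -- The image of the symmetric map B is the annihilator of its kernel, so l is nonzero somewhere on
  -- the radical. Along such an r the form f is constant, and l - f is affine with nonzero slope.
  obtain ⟨r, hr, hlr⟩ : ∃ r ∈ LinearMap.ker B, l r ≠ 0 := by
    by_contra! h
    apply hl
    have hfl : B.flip = B := by ext x y; exact hs y x
    have := LinearMap.range_dualMap_eq_dualAnnihilator_ker B
    have hm : l ∈ (LinearMap.ker B).dualAnnihilator :=
      (Submodule.mem_dualAnnihilator l).2 fun w hw => h w hw
    rw [← this] at hm
    obtain ⟨φ, hφ⟩ := hm
    obtain ⟨x, rfl⟩ := (Module.evalEquiv K V).surjective φ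
    refine ⟨x, ?_⟩
    rw [← hφ]
    ext y
    simp [hs x y]
  have := card_mul_card_level (fun _ : V => True) (fun y => l y - f y) ((l r)⁻¹ • r) (by simp)
    (by
      intro x t
      have hk : (t • (l r)⁻¹ • r) ∈ LinearMap.ker B :=
        Submodule.smul_mem _ _ (Submodule.smul_mem _ _ hr)
      rw [hf, eq_zero_of_mem_ker h2 hB hk, hs, LinearMap.mem_ker.1 hk]
      simp [hlr]
      ring) 0
  simpa [sub_eq_zero, eq_comm (a := l _)] using this

/-- Functionals in the image of the polar form, by completing the square. -/
theorem card_eq_of_polar (hB : ∀ x, B x x = 2 * f x)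
    (hf : ∀ x y, f (x + y) = f x + f y + B x y) (x : V) :
    Nat.card {y // f y = B x y} = Nat.card {y // f y = f x} := by
  refine Nat.card_congr ((Equiv.subRight x).subtypeEquiv fun y => ?_)
  have h1 := hf x (y - x)
  rw [add_sub_cancel, map_sub, hB] at h1
  simp only [Equiv.subRight_apply]
  constructor
  · intro h; linear_combination h - h1
  · intro h; linear_combination h + h1

/-- The form f is constant on the fibres of B, which are cosets of the radical, so each functional
accounts for |ker B| vectors. -/
theorem card_ker_mul_card_image (h2 : (2 : K) ≠ 0) (hB : ∀ x, B x x = 2 * f x)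
    (hf : ∀ x y, f (x + y) = f x + f y + B x y) (S : K → Prop) :
    Nat.card (LinearMap.ker B) * Nat.card {l : V →ₗ[K] K // ∃ x, B x = l ∧ S (f x)} =
      Nat.card {x // S (f x)} := by
  rw [← Nat.card_prod]
  have hfr : ∀ r ∈ LinearMap.ker B, ∀ x, f (r + x) = f x := by
    intro r hr x
    rw [hf, eq_zero_of_mem_ker h2 hB hr, LinearMap.mem_ker.1 hr]
    simp
  let g : LinearMap.ker B × {l : V →ₗ[K] K // ∃ x, B x = l ∧ S (f x)} → {x // S (f x)} :=
    fun z => ⟨z.1.1 + z.2.2.choose, by rw [hfr _ z.1.2]; exact z.2.2.choose_spec.2⟩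
  refine Nat.card_eq_of_bijective g ⟨?_, ?_⟩
  · rintro ⟨r, l⟩ ⟨r', l'⟩ h
    have h1 : r.1 + l.2.choose = r'.1 + l'.2.choose := congrArg Subtype.val h
    have h3 := congrArg B h1
    rw [map_add, map_add, LinearMap.mem_ker.1 r.2, LinearMap.mem_ker.1 r'.2, zero_add, zero_add,
      l.2.choose_spec.1, l'.2.choose_spec.1] at h3
    have h4 : l = l' := Subtype.ext h3
    subst h4
    simpa using h1
  · rintro ⟨x, hx⟩
    let l : {l : V →ₗ[K] K // ∃ x, B x = l ∧ S (f x)} := ⟨B x, x, rfl, hx⟩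
    have hl : B l.2.choose = B x := l.2.choose_spec.1
    refine ⟨⟨⟨x - l.2.choose, ?_⟩, l⟩, ?_⟩
    · rw [LinearMap.mem_ker, map_sub, hl, sub_self]
    · exact Subtype.ext (sub_add_cancel _ _)

end QuadraticCounting

/-! ### Roots of unity and Frobenius powers in a finite field -/

section RootsOfUnity

variable {F : Type*} [Field F]

theorem exists_unit_orderOf_eq [Finite F] : ∃ g : Fˣ, orderOf g = Nat.card F - 1 := by
  obtain ⟨g, hg⟩ := IsCyclic.exists_ofOrder_eq_natCard (α := Fˣ)
  exact ⟨g, by rw [hg, Nat.card_units]⟩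

/-- The number of solutions of `S (y ^ k)` is divisible by the order of every group of `k`-th roots
of unity, provided that `0` is not a solution. -/
theorem dvd_card_of_pow [Finite F] {d k : ℕ} (hk : k ≠ 0) (hdk : d ∣ k) (hd : d ∣ Nat.card F - 1)
    (S : F → Prop) (h0 : ¬ S 0) : d ∣ Nat.card {y : F // S (y ^ k)} := by
  obtain ⟨g, hg⟩ := exists_unit_orderOf_eq (F := F)
  obtain ⟨e, he⟩ := hd
  have hq : Nat.card F - 1 ≠ 0 := by
    have : 1 < Nat.card F := Finite.one_lt_card
    omega
  have hd0 : e ≠ 0 := by rintro rfl; simp_all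
  have hw : orderOf (g ^ e) = d := by
    rw [orderOf_pow_of_dvd hd0 (by rw [hg, he]; exact Dvd.intro_left d rfl), hg, he]
    exact Nat.mul_div_cancel _ (Nat.pos_of_ne_zero hd0)
  let H := Subgroup.zpowers (g ^ e)
  have hH : Nat.card H = d := by rw [Nat.card_zpowers, hw]
  have hHk : ∀ h ∈ H, h ^ k = 1 := by
    intro h hh
    obtain ⟨i, rfl⟩ := Subgroup.mem_zpowers_iff.1 hh
    obtain ⟨c, rfl⟩ := hdk
    rw [← zpow_natCast, ← zpow_mul, mul_comm, zpow_mul, zpow_natCast, pow_mul, ← hw,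
      pow_orderOf_eq_one, one_pow, one_zpow]
  let T : Set Fˣ := {y | S ((y : F) ^ k)}
  -- Multiplication by H leaves y^k unchanged, so T is a union of cosets of H.
  have hT : T = QuotientGroup.mk (s := H) ⁻¹' (QuotientGroup.mk (s := H) '' T) := by
    refine (Set.subset_preimage_image _ _).antisymm ?_
    rintro y ⟨x, hx, hxy⟩
    have h1 := hHk _ (QuotientGroup.eq.1 hxy)
    have h2 : y ^ k = x ^ k := by
      rw [mul_pow, inv_pow] at h1
      exact (inv_mul_eq_one.1 h1).symm
    have h3 : (y : F) ^ k = (x : F) ^ k := by exact_mod_cast congrArg Units.val h2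
    simpa only [T, Set.mem_ofPred_eq, h3] using hx
  have e1 : {y : F // S (y ^ k)} ≃ T :=
    { toFun := fun y => ⟨Units.mk0 y.1 (by
        rintro h
        have := y.2
        rw [h, zero_pow hk] at this
        exact h0 this), y.2⟩
      invFun := fun y => ⟨y.1, y.2⟩
      left_inv := fun y => rfl
      right_inv := fun y => by ext; rfl }
  rw [Nat.card_congr e1, hT, Nat.card_congr (QuotientGroup.preimageMkEquivSubgroupProdSet _ _),
    Nat.card_prod, hH]
  exact dvd_mul_right _ _

theorem pow_pow_add_mul {p : ℕ} {M : Type*} [Monoid M] (x : M) (a b k : ℕ) (h : x ^ (p ^ a) = x) :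
    x ^ (p ^ (b + a * k)) = x ^ (p ^ b) := by
  induction k with
  | zero => rfl
  | succ k ih =>
    rw [mul_add, mul_one, ← add_assoc, add_comm, pow_add p a, pow_mul, h, ih]

/-- The n with x^(p^n) = x are the periods of x under y ↦ y^p, hence closed under gcd; b is a period
of every element. -/
theorem pow_eq_self_iff_gcd {p : ℕ} (a b : ℕ) (hb : ∀ x : F, x ^ (p ^ b) = x) (x : F) :
    x ^ (p ^ a) = x ↔ x ^ (p ^ (Nat.gcd a b)) = x := by
  have hit : ∀ k, (fun y : F => y ^ p)^[k] x = x ^ (p ^ k) := fun k => by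
    rw [pow_iterate]
  constructor
  · intro h
    have := Function.IsPeriodicPt.gcd (f := fun y : F => y ^ p) (x := x) (m := a) (n := b)
      (by rw [Function.IsPeriodicPt, Function.IsFixedPt, hit, h])
      (by rw [Function.IsPeriodicPt, Function.IsFixedPt, hit, hb])
    rwa [Function.IsPeriodicPt, Function.IsFixedPt, hit] at this
  · intro h
    obtain ⟨k, hk⟩ := Nat.gcd_dvd_left a b
    have := pow_pow_add_mul (p := p) x _ 0 k h
    rwa [zero_add, ← hk, pow_zero, pow_one] at this

variable {p : ℕ} [hp : Fact p.Prime]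

theorem pow_sub_one_mul_self (x : F) (n : ℕ) : x ^ (p ^ n) = x ^ (p ^ n - 1) * x := by
  rw [← pow_succ, Nat.sub_add_cancel (Nat.pow_pos hp.1.pos)]

variable {m n u v w : ℕ}

/-- The fixed points are 0 and the roots of unity of order dividing p^v - 1, all present because p^v
- 1 ∣ q - 1. -/
theorem card_pow_eq_self [Finite F] (hv : 0 < v) (hF : Nat.card F = p ^ m) (hvm : v ∣ m) :
    Nat.card {x : F // x ^ (p ^ v) = x} = p ^ v := by
  classical
  have := Fintype.ofFinite F
  have h1 : 1 < p ^ v := Nat.one_lt_pow hv.ne' hp.1.one_lt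
  let e : {x : F // x ^ (p ^ v) = x} ≃ Option {x : Fˣ // x ^ (p ^ v - 1) = 1} := by
    refine (Equiv.ofBijective (fun o : Option {x : Fˣ // x ^ (p ^ v - 1) = 1} =>
      (o.elim ⟨0, zero_pow (by omega)⟩ fun x => ⟨x.1, by
        rw [pow_sub_one_mul_self, ← Units.val_pow_eq_pow_val, x.2, Units.val_one, one_mul]⟩ :
        {x : F // x ^ (p ^ v) = x})) ⟨?_, ?_⟩).symm
    · rintro (_ | ⟨x, hx⟩) (_ | ⟨y, hy⟩) h
      · rfl
      · exact absurd (congrArg Subtype.val h).symm y.ne_zero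
      · exact absurd (congrArg Subtype.val h) x.ne_zero
      · have : (x : F) = y := congrArg Subtype.val h
        simpa [Units.ext_iff] using this
    · rintro ⟨x, hx⟩
      by_cases h0 : x = 0
      · exact ⟨none, Subtype.ext h0.symm⟩
      · refine ⟨some ⟨Units.mk0 x h0, ?_⟩, rfl⟩
        ext
        rw [pow_sub_one_mul_self] at hx
        simpa [h0] using hx
  rw [Nat.card_congr e, Finite.card_option]
  have h2 : Nat.card {x : Fˣ // x ^ (p ^ v - 1) = 1} = p ^ v - 1 := by
    have h3 := IsCyclic.card_powMonoidHom_ker Fˣ (p ^ v - 1)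
    rw [Nat.card_units, hF, Nat.gcd_eq_right] at h3
    · exact Eq.trans (Nat.card_congr <| Equiv.subtypeEquivRight fun x => by
        rw [MonoidHom.mem_ker, powMonoidHom_apply]) h3
    · exact Nat.pow_sub_one_dvd_pow_sub_one p hvm
  rw [h2]
  omega

/-- The linearized polynomial `x ^ (p ^ 2u) + x` has `p ^ 2v` roots. -/
theorem card_pow_add_self_eq_zero [Finite F] (hpo : Odd p) (hv : 0 < v) (hn : 0 < n) (hF : Nat.card F = p ^ m)
    (hm : m = 4 * v * n) (hu : u = v * w) (hw : Odd w) (hg : Nat.gcd m u = v) :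
    Nat.card {x : F // x ^ (p ^ (2 * u)) + x = 0} = p ^ (2 * v) := by
  have := Fintype.ofFinite F
  have hfr : ∀ x : F, x ^ (p ^ m) = x := fun x => by
    rw [← hF, Nat.card_eq_fintype_card, FiniteField.pow_card]
  obtain ⟨g, hgo⟩ := exists_unit_orderOf_eq (F := F)
  obtain ⟨c, hc⟩ : p ^ (4 * v) - 1 ∣ p ^ m - 1 :=
    Nat.pow_sub_one_dvd_pow_sub_one p (hm ▸ Dvd.intro _ rfl)
  have h2v : 1 < p ^ (2 * v) := Nat.one_lt_pow (by omega) hp.1.one_lt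
  have h4v : p ^ (4 * v) - 1 = (p ^ (2 * v) - 1) * (p ^ (2 * v) + 1) := by
    rw [mul_comm (p ^ (2 * v) - 1), ← Nat.sq_sub_sq, one_pow, ← pow_mul]
    ring_nf
  obtain ⟨e, he⟩ : 2 ∣ p ^ (2 * v) + 1 := (hpo.pow.add_odd odd_one).two_dvd
  have hm1 : p ^ m - 1 = 2 * ((p ^ (2 * v) - 1) * (e * c)) := by
    rw [hc, h4v, he]; ring
  have hm0 : p ^ m - 1 ≠ 0 := by
    have : 1 < p ^ m := Nat.one_lt_pow (by rw [hm]; positivity) hp.1.one_lt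
    omega
  -- The exponent is (q-1)/(2(p^(2v)-1)), an integer because 4v ∣ m. It makes z^(p^(2v)-1) equal to
  -- -1. As w is odd, also z^(p^(2u)) = -z, so division by z carries the roots to the fixed points
  -- of x ↦ x^(p^(2u)).
  let z : F := ((g ^ (e * c) : Fˣ) : F)
  have hz0 : z ≠ 0 := Units.ne_zero _
  have hz : z ^ (p ^ (2 * v)) = -z := by
    have h1 : (z ^ (p ^ (2 * v) - 1)) ^ 2 = 1 := by
      rw [← pow_mul, ← Units.val_pow_eq_pow_val, ← pow_mul,
        show e * c * ((p ^ (2 * v) - 1) * 2) = p ^ m - 1 by rw [hm1]; ring, ← hF, ← hgo,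
        pow_orderOf_eq_one, Units.val_one]
    have h2 : z ^ (p ^ (2 * v) - 1) ≠ 1 := by
      intro h
      have h3 : g ^ (e * c * (p ^ (2 * v) - 1)) = 1 := by
        ext
        rw [pow_mul, Units.val_pow_eq_pow_val, h, Units.val_one]
      have h4 := orderOf_dvd_of_pow_eq_one h3
      rw [hgo, hF] at h4
      have h5 : e * c * (p ^ (2 * v) - 1) ≠ 0 := by
        intro h; apply hm0; rw [hm1]; rw [mul_comm (p ^ (2 * v) - 1), h]
      have h6 := Nat.le_of_dvd (Nat.pos_of_ne_zero h5) h4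
      rw [hm1, mul_comm (p ^ (2 * v) - 1)] at h6
      omega
    rw [pow_sub_one_mul_self, (sq_eq_one_iff.1 h1).resolve_left h2, neg_one_mul]
  have hz2 : z ^ (p ^ (2 * u)) = -z := by
    obtain ⟨j, rfl⟩ := hw
    have h4 : z ^ (p ^ (4 * v)) = z := by
      rw [show 4 * v = 2 * v + 2 * v by ring, pow_add, pow_mul, hz, (hpo.pow).neg_pow, hz, neg_neg]
    rw [hu, show 2 * (v * (2 * j + 1)) = 2 * v + 4 * v * j by ring, pow_pow_add_mul z _ _ _ h4, hz]
  have hgcd : Nat.gcd (2 * u) m = 2 * v := by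
    have h1 : Nat.gcd (2 * u) m = v * Nat.gcd (2 * w) (2 * (2 * n)) := by
      rw [← Nat.gcd_mul_left, hu, hm]; ring_nf
    have h2 : v * Nat.gcd (4 * n) w = v * 1 := by
      rw [← Nat.gcd_mul_left, mul_one, ← mul_assoc, mul_comm v 4, ← hm, ← hu, hg]
    have h3 := Nat.eq_of_mul_eq_mul_left hv h2
    have h4 : Nat.gcd w (2 * n) = 1 :=
      Nat.Coprime.coprime_dvd_right ⟨2, by ring⟩ (Nat.Coprime.symm h3)
    rw [h1, Nat.gcd_mul_left, h4]
    ring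
  rw [← card_pow_eq_self (F := F) (v := 2 * v) (by omega) hF (hm ▸ ⟨2 * n, by ring⟩)]
  refine Nat.card_congr ((Equiv.mulLeft₀ z⁻¹ (inv_ne_zero hz0)).subtypeEquiv fun x => ?_)
  rw [← hgcd, ← pow_eq_self_iff_gcd _ _ hfr, Equiv.mulLeft₀_apply, mul_pow, inv_pow, hz2,
    inv_neg, neg_mul, neg_eq_iff_eq_neg, ← mul_neg, mul_right_inj' (inv_ne_zero hz0), eq_neg_iff_add_eq_zero]

/-- Every root of unity of order dividing `p - 1` is a `(p ^ u + 1)`-th power. -/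
theorem exists_pow_eq_of_pow_eq_one [Finite F] (hF : Nat.card F = p ^ m)
    (hm : m = 4 * v * n) (hu : u = v * w) (hw : Odd w) (t : F) (ht : t ^ (p - 1) = 1) :
    ∃ x : F, x ^ (p ^ u + 1) = t := by
  have hp1 : 0 < p - 1 := Nat.sub_pos_of_lt hp.1.one_lt
  obtain ⟨g, hg⟩ := IsCyclic.exists_generator (α := Fˣ)
  have hgo : orderOf g = p ^ m - 1 := by
    rw [orderOf_eq_card_of_forall_mem_zpowers hg, Nat.card_units, hF]
  have ht0 : t ≠ 0 := by rintro rfl; rw [zero_pow hp1.ne'] at ht; exact zero_ne_one ht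
  obtain ⟨i, hi⟩ := (mem_powers_iff_mem_zpowers (x := g) (y := Units.mk0 t ht0)).2 (hg _)
  obtain ⟨a, ha⟩ : p ^ (2 * v) - 1 ∣ p ^ m - 1 :=
    Nat.pow_sub_one_dvd_pow_sub_one p (hm ▸ ⟨2 * n, by ring⟩)
  obtain ⟨b, hb⟩ : p - 1 ∣ p ^ v - 1 := by simpa using Nat.pow_sub_one_dvd_pow_sub_one p (one_dvd v)
  have h2v : p ^ (2 * v) - 1 = (p ^ v + 1) * (p ^ v - 1) := by
    rw [← Nat.sq_sub_sq, one_pow, ← pow_mul, mul_comm]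
  simp only at hi
  have h1 : p ^ m - 1 ∣ i * (p - 1) := by
    rw [← hgo]
    apply orderOf_dvd_of_pow_eq_one
    rw [pow_mul, hi]
    ext
    simpa using ht
  have h2 : p ^ m - 1 = (p - 1) * ((p ^ v + 1) * b * a) := by rw [ha, h2v, hb]; ring
  rw [h2, mul_comm i] at h1
  obtain ⟨c, hc⟩ := Nat.dvd_of_mul_dvd_mul_left hp1 h1
  -- Here t = g^i with i = (p^v+1)bac. This x is fixed by the p^(2v)-th power map, and u is v plus a
  -- multiple of 2v, so its p^u-th and p^v-th powers agree.
  let x : F := ((g ^ (b * a * c) : Fˣ) : F)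
  have hx : x ^ (p ^ (2 * v)) = x := by
    rw [pow_sub_one_mul_self, ← Units.val_pow_eq_pow_val, ← pow_mul,
      show b * a * c * (p ^ (2 * v) - 1) = (p ^ m - 1) * (b * c) by rw [ha]; ring, pow_mul g, ← hgo,
      pow_orderOf_eq_one, one_pow, Units.val_one, one_mul]
  refine ⟨x, ?_⟩
  obtain ⟨j, rfl⟩ := hw
  rw [hu, show v * (2 * j + 1) = v + 2 * v * j by ring, pow_succ, pow_pow_add_mul x _ _ _ hx,
    ← pow_succ, ← Units.val_pow_eq_pow_val, ← pow_mul,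
    show b * a * c * (p ^ v + 1) = i by rw [hc]; ring, hi]
  rfl

end RootsOfUnity

/-! ### The quadratic form Tr(y^(p^u+1)), its radical and its levels -/

section GoldForm

variable (p : ℕ) [hp : Fact p.Prime] {F : Type*} [Field F] [Algebra (ZMod p) F]

theorem trace_pow_card_pow [Finite F] (u : ℕ) (z : F) :
    Algebra.trace (ZMod p) F (z ^ (p ^ u)) = Algebra.trace (ZMod p) F z := by
  induction u with
  | zero => simp
  | succ u ih =>
    have h := Algebra.trace_eq_of_algEquiv (FiniteField.frobeniusAlgEquivOfAlgebraic (ZMod p) F)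
      (z ^ (p ^ u))
    rw [FiniteField.coe_frobeniusAlgEquivOfAlgebraic, ZMod.card] at h
    rw [pow_succ, pow_mul, ← ih]
    exact h

/-- The trace form as an isomorphism between a finite field and its dual over the prime field. -/
noncomputable def traceDual [Finite F] : F ≃ₗ[ZMod p] Module.Dual (ZMod p) F :=
  (Algebra.traceForm (ZMod p) F).toDual (traceForm_nondegenerate (ZMod p) F)

@[simp]
theorem traceDual_apply [Finite F] (b y : F) :
    traceDual p b y = Algebra.trace (ZMod p) F (b * y) := by
  rw [traceDual, LinearMap.BilinForm.toDual_def, Algebra.traceForm_apply]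

theorem add_pow_prime_pow (u : ℕ) (x y : F) : (x + y) ^ (p ^ u) = x ^ (p ^ u) + y ^ (p ^ u) := by
  have : CharP F p := charP_of_injective_algebraMap (algebraMap (ZMod p) F).injective p
  exact add_pow_char_pow x y p u

theorem smul_pow_prime_pow (u : ℕ) (c : ZMod p) (x : F) :
    (c • x) ^ (p ^ u) = c • x ^ (p ^ u) := by
  rw [smul_pow, ZMod.pow_card_pow]

/-- The quadratic form `y ↦ Tr(y ^ (p ^ u + 1))` over the prime field. -/
noncomputable def goldForm (u : ℕ) (y : F) : ZMod p := Algebra.trace (ZMod p) F (y ^ (p ^ u + 1))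

/-- The polar form of `goldForm`. -/
noncomputable def goldPolar (u : ℕ) : F →ₗ[ZMod p] F →ₗ[ZMod p] ZMod p :=
  LinearMap.mk₂ (ZMod p)
    (fun x y => Algebra.trace (ZMod p) F (x ^ (p ^ u) * y + x * y ^ (p ^ u)))
    (fun x x' y => by rw [← map_add, add_pow_prime_pow]; congr 1; ring)
    (fun c x y => by
      rw [← map_smul, smul_pow_prime_pow, smul_add, smul_mul_assoc, smul_mul_assoc])
    (fun x y y' => by rw [← map_add, add_pow_prime_pow]; congr 1; ring)
    (fun c x y => by
      rw [← map_smul, smul_pow_prime_pow, smul_add, mul_smul_comm, mul_smul_comm])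

variable {p} {u : ℕ}

theorem goldPolar_apply (x y : F) :
    goldPolar p u x y = Algebra.trace (ZMod p) F (x ^ (p ^ u) * y + x * y ^ (p ^ u)) := rfl

theorem goldPolar_comm (x y : F) : goldPolar p u x y = goldPolar p u y x := by
  rw [goldPolar_apply, goldPolar_apply]
  congr 1
  ring

theorem goldPolar_self (x : F) : goldPolar p u x x = 2 * goldForm p u x := by
  rw [goldPolar_apply, goldForm, two_mul, ← map_add]
  congr 1
  ring

theorem goldForm_add (x y : F) :
    goldForm p u (x + y) = goldForm p u x + goldForm p u y + goldPolar p u x y := by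
  rw [goldPolar_apply, goldForm, goldForm, goldForm, ← map_add, ← map_add, pow_succ,
    add_pow_prime_pow]
  congr 1
  ring

/-- Frobenius invariance of the trace gives B(x,y) = Tr((x^(p^(2u)) + x) y^(p^u)). Since y^(p^u)
runs through all of F, nondegeneracy of the trace form applies. -/
theorem mem_ker_goldPolar [Finite F] (x : F) :
    x ∈ LinearMap.ker (goldPolar p u : F →ₗ[ZMod p] _) ↔ x ^ (p ^ (2 * u)) + x = 0 := by
  have key : ∀ y, goldPolar p u x y = traceDual p (x ^ (p ^ (2 * u)) + x) (y ^ (p ^ u)) := by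
    intro y
    rw [goldPolar_apply, traceDual_apply, map_add, ← trace_pow_card_pow p u (x ^ (p ^ u) * y),
      ← map_add, mul_pow, ← pow_mul, ← pow_add, ← two_mul, add_mul]
  rw [LinearMap.mem_ker, ← (traceDual p).map_eq_zero_iff]
  constructor
  · intro h
    have : CharP F p := charP_of_injective_algebraMap (algebraMap (ZMod p) F).injective p
    ext z
    obtain ⟨y, rfl⟩ := (bijective_iterateFrobenius F p u).surjective z
    rw [iterateFrobenius_def, ← key, h]
    rfl
  · intro h
    ext y
    rw [key, h]
    rfl

section Levels

variable [Finite F] {m n v w : ℕ}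

/-- Writing t = c^(p^u+1), multiplication by c carries level 1 onto level t. -/
theorem card_goldForm_eq (hF : Nat.card F = p ^ m)
    (hm : m = 4 * v * n) (hu : u = v * w) (hw : Odd w) (t : ZMod p) (ht : t ≠ 0) :
    Nat.card {x : F // goldForm p u x = t} = Nat.card {x : F // goldForm p u x = 1} := by
  obtain ⟨c, hc⟩ := exists_pow_eq_of_pow_eq_one (F := F) hF hm hu hw (algebraMap (ZMod p) F t)
    (by rw [← map_pow, ZMod.pow_card_sub_one_eq_one ht, map_one])
  have hc0 : c ≠ 0 := by
    rintro rfl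
    rw [zero_pow (by omega), eq_comm, map_eq_zero] at hc
    exact ht hc
  refine (Nat.card_congr ((Equiv.mulLeft₀ c hc0).subtypeEquiv fun x => ?_)).symm
  rw [Equiv.mulLeft₀_apply, goldForm, goldForm, mul_pow, hc, ← Algebra.smul_def, map_smul,
    smul_eq_mul, mul_eq_left₀ ht]

/-- Both p^u + 1 (w being odd) and q - 1 are divisible by p^v + 1, so the roots of unity of that
order act freely on the level set. This divisibility later fixes the sign of Z - N. -/
theorem dvd_card_goldForm_eq (hF : Nat.card F = p ^ m)
    (hm : m = 4 * v * n) (hu : u = v * w) (hw : Odd w) (t : ZMod p) (ht : t ≠ 0) :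
    p ^ v + 1 ∣ Nat.card {x : F // goldForm p u x = t} := by
  refine dvd_card_of_pow (k := p ^ u + 1) (by omega) ?_ ?_
    (fun z => Algebra.trace (ZMod p) F z = t) (by simpa using ht.symm)
  · simpa [hu, pow_mul] using hw.nat_add_dvd_pow_add_pow (p ^ v) 1
  · rw [hF]
    refine Dvd.dvd.trans ⟨p ^ v - 1, ?_⟩ (Nat.pow_sub_one_dvd_pow_sub_one p (m := 2 * v) ?_)
    · rw [← Nat.sq_sub_sq, one_pow, ← pow_mul, mul_comm]
    · exact hm ▸ ⟨2 * n, by ring⟩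

theorem two_ne_zero_zmod (hpo : Odd p) : (2 : ZMod p) ≠ 0 := by
  have : p ≠ 2 := by rintro rfl; exact absurd hpo (by decide)
  have : Fact (2 < p) := ⟨lt_of_le_of_ne hp.1.two_le this.symm⟩
  exact Ring.two_ne_zero (by rw [ZMod.ringChar_zmod_n]; exact ‹p ≠ 2›)

theorem card_ker_goldPolar (hpo : Odd p) (hv : 0 < v) (hn : 0 < n) (hF : Nat.card F = p ^ m)
    (hm : m = 4 * v * n) (hu : u = v * w) (hw : Odd w) (hg : Nat.gcd m u = v) :
    Nat.card (LinearMap.ker (goldPolar p u : F →ₗ[ZMod p] _)) = p ^ (2 * v) := by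
  rw [← card_pow_add_self_eq_zero (F := F) hpo hv hn hF hm hu hw hg]
  exact Nat.card_congr (Equiv.subtypeEquivRight fun x => mem_ker_goldPolar x)

/-- The level sets of `goldForm`: the form is of elliptic type modulo its radical. -/
theorem card_levels_goldForm (hpo : Odd p) (hv : 0 < v) (hn : 0 < n) (hF : Nat.card F = p ^ m)
    (hm : m = 4 * v * n) (hu : u = v * w) (hw : Odd w) (hg : Nat.gcd m u = v) :
    (p : ℤ) * Nat.card {x : F // goldForm p u x = 0} =
        p ^ m - (p - 1) * p ^ (2 * v * n + v) ∧
    (p : ℤ) * Nat.card {x : F // goldForm p u x = 1} = p ^ m + p ^ (2 * v * n + v) := by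
  have hN := card_goldForm_eq (F := F) hF hm hu hw
  have h1 := sq_card_sub_card (two_ne_zero_zmod hpo) (goldPolar_self (F := F) (u := u))
    goldForm_add _ hN
  have h2 := card_eq_add _ _ hN
  have h3 := dvd_card_goldForm_eq (F := F) hF hm hu hw 1 one_ne_zero
  have hk := card_ker_goldPolar (F := F) hpo hv hn hF hm hu hw hg
  rw [hk, hF] at h1
  rw [hF, Nat.card_zmod] at h2
  generalize Nat.card {x : F // goldForm p u x = 0} = Z at *
  generalize Nat.card {x : F // goldForm p u x = 1} = N at *
  have hp2 := hp.1.two_le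
  zify [hp.1.one_le] at h1 h2 h3
  have h4 : ((Z : ℤ) - N) ^ 2 = ((p : ℤ) ^ (2 * v * n + v)) ^ 2 := by
    rw [h1, ← pow_add, ← pow_mul, hm]
    ring_nf
  -- Modulo p^v + 1 one has p^m ≡ 1 and p^(2vn+v) ≡ -1. The positive sign would give pN ≡ 2, while N
  -- ≡ 0, forcing p^v + 1 ∣ 2.
  have hs : (Z : ℤ) - N = - (p : ℤ) ^ (2 * v * n + v) := by
    refine (sq_eq_sq_iff_eq_or_eq_neg.1 h4).resolve_left fun h5 => ?_
    have h6 : (p : ℤ) * N = p ^ m - p ^ (2 * v * n + v) := by linear_combination -h2 - h5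
    have h7 : (p : ℤ) ^ v + 1 ∣ p ^ m - 1 := by
      have := sub_dvd_pow_sub_pow ((p : ℤ) ^ v) (-1) (4 * n)
      rw [← pow_mul, show v * (4 * n) = m by rw [hm]; ring, Even.neg_one_pow ⟨2 * n, by ring⟩] at this
      simpa using this
    have h8 : (p : ℤ) ^ v + 1 ∣ p ^ (2 * v * n + v) + 1 := by
      have := sub_dvd_pow_sub_pow ((p : ℤ) ^ v) (-1) (2 * n + 1)
      rw [← pow_mul, show v * (2 * n + 1) = 2 * v * n + v by ring, Odd.neg_one_pow ⟨n, rfl⟩] at this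
      simpa using this
    have h9 : (p : ℤ) ^ v + 1 ∣ 2 := by
      have := (h3.mul_left (p : ℤ)).sub (h7.sub h8)
      rwa [h6, show (p : ℤ) ^ m - p ^ (2 * v * n + v) - (p ^ m - 1 - (p ^ (2 * v * n + v) + 1)) = 2 by
        ring] at this
    have h10 := Int.le_of_dvd (by norm_num) h9
    have h11 : (p : ℤ) ≤ p ^ v := by exact_mod_cast Nat.le_self_pow hv.ne' p
    have : (2 : ℤ) ≤ p := by exact_mod_cast hp2
    linarith
  constructor
  · linear_combination ((p : ℤ) - 1) * hs - h2
  · linear_combination -hs - h2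

end Levels

end GoldForm

/-! ### Weights of the codewords -/

section Weights

variable {p : ℕ} [hp : Fact p.Prime] {F : Type*} [Field F] [Algebra (ZMod p) F] {u : ℕ}

theorem card_mul_card_trace_add_goldForm [Finite F] (P : F → Prop) :
    p * Nat.card {z : F × F // P z.2 ∧ Algebra.trace (ZMod p) F z.1 + goldForm p u z.2 = 0} =
      Nat.card F * Nat.card {y // P y} := by
  obtain ⟨e, he⟩ := Algebra.trace_surjective (ZMod p) F 1
  have := card_mul_card_level (K := ZMod p) (fun z : F × F => P z.2)
    (fun z => Algebra.trace (ZMod p) F z.1 + goldForm p u z.2) (e, 0) (by simp)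
    (by intro z t; simp [he]; ring) 0
  rw [Nat.card_zmod] at this
  rw [this, ← Nat.card_prod]
  exact Nat.card_congr
    { toFun := fun z => (z.1.1, ⟨z.1.2, z.2⟩)
      invFun := fun z => ⟨(z.1, z.2.1), z.2.2⟩
      left_inv := fun z => rfl
      right_inv := fun z => rfl }

/-- If Tr(a·) vanished on the kernel of Tr, it would be a scalar multiple of Tr and a would lie in
𝔽_p. Hence some shift of x preserves Tr(x) and moves Tr(ax). -/
theorem card_mul_card_trace_add_goldForm_of_notMem_range [Finite F] (a b : F)
    (ha : a ∉ Set.range (algebraMap (ZMod p) F)) :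
    p * Nat.card {z : F × F // Algebra.trace (ZMod p) F z.1 + goldForm p u z.2 = 0 ∧
      Algebra.trace (ZMod p) F (a * z.1 + b * z.2) = 0} =
    Nat.card {z : F × F // Algebra.trace (ZMod p) F z.1 + goldForm p u z.2 = 0} := by
  obtain ⟨e, he0, he1⟩ : ∃ e, Algebra.trace (ZMod p) F e = 0 ∧
      Algebra.trace (ZMod p) F (a * e) ≠ 0 := by
    by_contra! h
    obtain ⟨e, he⟩ := Algebra.trace_surjective (ZMod p) F 1
    refine ha ⟨Algebra.trace (ZMod p) F (a * e), ?_⟩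
    apply (traceDual p).injective
    ext x
    have := h (x - Algebra.trace (ZMod p) F x • e) (by simp [he])
    rw [mul_sub, map_sub, mul_smul_comm, map_smul, sub_eq_zero] at this
    rw [traceDual_apply, traceDual_apply, this, ← Algebra.smul_def, map_smul, smul_eq_mul,
      smul_eq_mul, mul_comm]
  have := card_mul_card_level (K := ZMod p)
    (fun z : F × F => Algebra.trace (ZMod p) F z.1 + goldForm p u z.2 = 0)
    (fun z => Algebra.trace (ZMod p) F (a * z.1 + b * z.2))
    ((Algebra.trace (ZMod p) F (a * e))⁻¹ • e, 0)
    (by intro z t; simp [he0]) (by intro z t; simp [mul_add, he1]; ring) 0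
  rwa [Nat.card_zmod] at this

theorem card_mul_card_zeros [Finite F] :
    p * Nat.card {z : F × F // Algebra.trace (ZMod p) F z.1 + goldForm p u z.2 = 0} =
      Nat.card F * Nat.card F := by
  have := card_mul_card_trace_add_goldForm (p := p) (u := u) (fun _ : F => True)
  simpa using this

/-- The pairs `(α, b)` with `α` a nonzero scalar such that the functional `α⁻¹ Tr(b ·)` is
represented through the polar form by a vector whose value under `goldForm` satisfies `S`. -/
def Represented (p u : ℕ) [Fact p.Prime] {F : Type*} [Field F] [Finite F] [Algebra (ZMod p) F]
    (S : ZMod p → Prop) (z : F × F) : Prop :=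
  ∃ α : ZMod p, α ≠ 0 ∧ z.1 = algebraMap (ZMod p) F α ∧
    ∃ x, goldPolar p u x = α⁻¹ • traceDual p z.2 ∧ S (goldForm p u x)

/-- A pair consists of one of p - 1 scalars α and a functional l = B(x,·) with S(Q(x)); b is then
the trace dual of αl. -/
theorem card_represented [Finite F] (hpo : Odd p) (S : ZMod p → Prop) :
    Nat.card (LinearMap.ker (goldPolar p u : F →ₗ[ZMod p] _)) *
      Nat.card {z : F × F // Represented p u S z} =
    (p - 1) * Nat.card {x : F // S (goldForm p u x)} := by
  rw [← card_ker_mul_card_image (two_ne_zero_zmod hpo) (goldPolar_self (F := F) (u := u))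
    goldForm_add S, mul_left_comm]
  congr 1
  have hu : Nat.card (ZMod p)ˣ = p - 1 := by rw [Nat.card_units, Nat.card_zmod]
  rw [← hu, ← Nat.card_prod]
  symm
  let g : (ZMod p)ˣ × {l : F →ₗ[ZMod p] ZMod p // ∃ x, goldPolar p u x = l ∧ S (goldForm p u x)} →
      {z : F × F // Represented p u S z} := fun z =>
    ⟨(algebraMap (ZMod p) F z.1, (traceDual p).symm ((z.1 : ZMod p) • z.2.1)),
      z.1, z.1.ne_zero, rfl, by
        obtain ⟨x, hx, hS⟩ := z.2.2
        refine ⟨x, ?_, hS⟩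
        rw [LinearEquiv.apply_symm_apply, smul_smul, inv_mul_cancel₀ z.1.ne_zero, one_smul, hx]⟩
  refine Nat.card_eq_of_bijective g ⟨?_, ?_⟩
  · rintro ⟨α, l⟩ ⟨α', l'⟩ h
    have h0 := congrArg Subtype.val h
    have h1 : algebraMap (ZMod p) F α = algebraMap (ZMod p) F α' := congrArg Prod.fst h0
    have h2 : (traceDual p).symm ((α : ZMod p) • l.1) = (traceDual p).symm ((α' : ZMod p) • l'.1) :=
      congrArg Prod.snd h0
    have h3 : α = α' := Units.ext ((algebraMap (ZMod p) F).injective h1)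
    subst h3
    have h4 := smul_right_injective _ α.ne_zero ((traceDual p).symm.injective h2)
    rw [Subtype.ext h4]
  · rintro ⟨⟨a, b⟩, α, hα, ha, x, hx, hS⟩
    refine ⟨⟨Units.mk0 α hα, α⁻¹ • traceDual p b, x, hx, hS⟩, Subtype.ext (Prod.ext ha.symm ?_)⟩
    simp [g, smul_smul, hα]

variable [Fintype F] [DecidableEq F]

theorem mem_D₁ (z : F × F) : z ∈ D₁ p F u ↔
    z ≠ 0 ∧ Algebra.trace (ZMod p) F z.1 + goldForm p u z.2 = 0 := by
  simp [D₁, goldForm, Prod.zero_eq_mk]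

/-- The origin, missing from D₁, has Tr(ax+by) = 0 and adds nothing to the weight, so the full zero
set may be used. -/
theorem hammingNorm_add_card (a b : F) :
    hammingNorm (codeword p (D₁ p F u) (a, b)) +
      Nat.card {z : F × F // Algebra.trace (ZMod p) F z.1 + goldForm p u z.2 = 0 ∧
        Algebra.trace (ZMod p) F (a * z.1 + b * z.2) = 0} =
    Nat.card {z : F × F // Algebra.trace (ZMod p) F z.1 + goldForm p u z.2 = 0} := by
  have h1 : hammingNorm (codeword p (D₁ p F u) (a, b)) =
      Nat.card {z : F × F // Algebra.trace (ZMod p) F z.1 + goldForm p u z.2 = 0 ∧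
        ¬ Algebra.trace (ZMod p) F (a * z.1 + b * z.2) = 0} := by
    rw [hammingNorm, ← Fintype.card_subtype, ← Nat.card_eq_fintype_card]
    exact Nat.card_congr
      { toFun := fun d => ⟨d.1.1, ((mem_D₁ _).1 d.1.2).2, d.2⟩
        invFun := fun z => ⟨⟨z.1, (mem_D₁ _).2 ⟨by
          rintro h
          have := z.2.2
          simp [h] at this, z.2.1⟩⟩, z.2.2⟩
        left_inv := fun z => rfl
        right_inv := fun z => rfl }
  rw [h1]
  simp only [Nat.card_eq_fintype_card, Fintype.card_subtype, ← Finset.filter_filter]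
  rw [add_comm]
  exact Finset.card_filter_add_card_filter_not _

theorem card_D₁ : p * (Fintype.card (D₁ p F u) + 1) = Nat.card F * Nat.card F := by
  rw [← card_mul_card_zeros (p := p) (u := u)]
  congr 1
  have h : insert 0 (D₁ p F u) =
      Finset.univ.filter fun z => Algebra.trace (ZMod p) F z.1 + goldForm p u z.2 = 0 := by
    ext z
    rw [Finset.mem_insert, mem_D₁, Finset.mem_filter]
    by_cases hz : z = 0
    · simp [hz, goldForm]
    · simp [hz]
  rw [Fintype.card_coe, Nat.card_eq_fintype_card, Fintype.card_subtype, ← h,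
    Finset.card_insert_of_notMem (by simp [mem_D₁])]

theorem weight_of_notMem_range (a b : F) (ha : a ∉ Set.range (algebraMap (ZMod p) F)) :
    (p : ℤ) ^ 2 * hammingNorm (codeword p (D₁ p F u) (a, b)) = (p - 1) * (Nat.card F : ℤ) ^ 2 := by
  have h1 := hammingNorm_add_card (p := p) (u := u) a b
  have h2 := card_mul_card_trace_add_goldForm_of_notMem_range (p := p) (u := u) a b ha
  have h3 := card_mul_card_zeros (p := p) (F := F) (u := u)
  zify at h1 h2 h3
  linear_combination (p : ℤ) ^ 2 * h1 - p * h2 + (p - 1) * h3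

theorem weight_of_eq_zero (b : F) (hb : b ≠ 0) :
    (p : ℤ) ^ 2 * hammingNorm (codeword p (D₁ p F u) (0, b)) = (p - 1) * (Nat.card F : ℤ) ^ 2 := by
  have h1 := hammingNorm_add_card (p := p) (u := u) (0 : F) b
  have h2 := card_mul_card_trace_add_goldForm (p := p) (u := u)
    (fun y : F => traceDual p b y = 0)
  have h3 := card_mul_card_zeros (p := p) (F := F) (u := u)
  have h4 := card_mul_card_add_eq_zero (traceDual p b) (by simpa using hb) 0
  simp only [zero_mul, zero_add, traceDual_apply, Nat.card_zmod, and_comm] at h1 h2 h4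
  zify at h1 h2 h3 h4
  linear_combination (p : ℤ) ^ 2 * h1 - p * h2 + p * h3 - Nat.card F * h4

/-- On the zero set Tr(αx) = -αQ(y), so the hyperplane condition involves y alone and x stays
subject only to its trace. -/
theorem weight_of_algebraMap (α : ZMod p) (hα : α ≠ 0) (b : F) :
    p * hammingNorm (codeword p (D₁ p F u) (algebraMap (ZMod p) F α, b)) +
      Nat.card F * Nat.card {y // goldForm p u y = (α⁻¹ • traceDual p b) y} =
    Nat.card F * Nat.card F := by
  have h1 := hammingNorm_add_card (p := p) (u := u) (algebraMap (ZMod p) F α) b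
  rw [← card_mul_card_zeros (p := p) (u := u), ← h1, mul_add, add_right_inj,
    ← card_mul_card_trace_add_goldForm (p := p) (u := u)]
  congr 1
  refine Nat.card_congr (Equiv.subtypeEquivRight fun z => ?_)
  rw [and_comm]
  refine and_congr_right fun h => ?_
  rw [LinearMap.smul_apply, traceDual_apply, smul_eq_mul, map_add, ← Algebra.smul_def, map_smul,
    smul_eq_mul, eq_inv_mul_iff_mul_eq₀ hα, eq_neg_of_add_eq_zero_left h]
  constructor
  · intro h'; linear_combination -h'
  · intro h'; linear_combination -h'

variable {m n v w : ℕ}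

theorem weight_of_represented_zero (hpo : Odd p) (hv : 0 < v) (hn : 0 < n)
    (hF : Nat.card F = p ^ m) (hm : m = 4 * v * n) (hu : u = v * w) (hw : Odd w)
    (hg : Nat.gcd m u = v) (z : F × F) (hz : Represented p u (· = 0) z) :
    (p : ℤ) ^ 2 * hammingNorm (codeword p (D₁ p F u) z) =
      (p - 1) * (p ^ m) ^ 2 + (p - 1) * p ^ m * p ^ (2 * v * n + v) := by
  obtain ⟨a, b⟩ := z
  obtain ⟨α, hα, rfl, x, hx, hS⟩ := hz
  have h1 := weight_of_algebraMap (u := u) α hα b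
  rw [← hx, card_eq_of_polar goldPolar_self goldForm_add, hS, hF] at h1
  have h2 := (card_levels_goldForm (F := F) hpo hv hn hF hm hu hw hg).1
  zify at h1
  linear_combination (p : ℤ) * h1 - p ^ m * h2

theorem weight_of_represented_ne_zero (hpo : Odd p) (hv : 0 < v) (hn : 0 < n)
    (hF : Nat.card F = p ^ m) (hm : m = 4 * v * n) (hu : u = v * w) (hw : Odd w)
    (hg : Nat.gcd m u = v) (z : F × F) (hz : Represented p u (· ≠ 0) z) :
    (p : ℤ) ^ 2 * hammingNorm (codeword p (D₁ p F u) z) =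
      (p - 1) * (p ^ m) ^ 2 - p ^ m * p ^ (2 * v * n + v) := by
  obtain ⟨a, b⟩ := z
  obtain ⟨α, hα, rfl, x, hx, hS⟩ := hz
  have h1 := weight_of_algebraMap (u := u) α hα b
  rw [← hx, card_eq_of_polar goldPolar_self goldForm_add,
    card_goldForm_eq hF hm hu hw _ hS, hF] at h1
  have h2 := (card_levels_goldForm (F := F) hpo hv hn hF hm hu hw hg).2
  zify at h1
  linear_combination (p : ℤ) * h1 - p ^ m * h2

theorem weight_of_not_represented (hpo : Odd p) (z : F × F) (hz : z ≠ 0)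
    (h0 : ¬ Represented p u (· = 0) z) (h1 : ¬ Represented p u (· ≠ 0) z) :
    (p : ℤ) ^ 2 * hammingNorm (codeword p (D₁ p F u) z) = (p - 1) * (Nat.card F : ℤ) ^ 2 := by
  obtain ⟨a, b⟩ := z
  by_cases ha : a ∈ Set.range (algebraMap (ZMod p) F)
  · obtain ⟨α, rfl⟩ := ha
    by_cases hα : α = 0
    · subst hα
      rw [map_zero]
      exact weight_of_eq_zero b (by rintro rfl; exact hz (by simp))
    · have h2 := weight_of_algebraMap (u := u) α hα b
      have h3 := card_mul_card_eq_of_not_mem_range (two_ne_zero_zmod hpo)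
        (goldPolar_self (F := F) (u := u)) goldForm_add goldPolar_comm (α⁻¹ • traceDual p b) (by
          rintro ⟨x, hx⟩
          by_cases hfx : goldForm p u x = 0
          · exact h0 ⟨α, hα, rfl, x, hx, hfx⟩
          · exact h1 ⟨α, hα, rfl, x, hx, hfx⟩)
      rw [Nat.card_zmod] at h3
      zify at h2 h3
      linear_combination (p : ℤ) * h2 - Nat.card F * h3
  · exact weight_of_notMem_range a b ha

end Weights

/-! ### From weights of codewords to the weight enumerator -/

section Enumerator

variable {p : ℕ} [hp : Fact p.Prime] {F : Type*} [Field F] [Algebra (ZMod p) F]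

theorem A_code_eq (D : Finset (F × F)) (h : Function.Injective (codeword p D)) (i : ℕ) :
    A (code p D) i = Nat.card {z : F × F // hammingNorm (codeword p D z) = i} := by
  rw [A, ← Nat.card_coe_set_eq]
  symm
  refine Nat.card_eq_of_bijective
    (fun z => ⟨codeword p D z.1, ⟨z.1, rfl⟩, z.2⟩) ⟨?_, ?_⟩
  · intro z z' hz
    exact Subtype.ext (h (congrArg Subtype.val hz))
  · rintro ⟨_, ⟨z, rfl⟩, hz⟩
    exact ⟨⟨z, hz⟩, rfl⟩

theorem finrank_code [Finite F] {m : ℕ} (hF : Nat.card F = p ^ m) (D : Finset (F × F))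
    (h : Function.Injective (codeword p D)) : Module.finrank (ZMod p) (code p D) = 2 * m := by
  rw [code, LinearMap.finrank_range_of_inj h, Module.finrank_prod, ← two_mul]
  congr 1
  have := Module.natCard_eq_pow_finrank (K := ZMod p) (V := F)
  rw [hF, Nat.card_zmod] at this
  exact (Nat.pow_right_injective hp.1.two_le this).symm

/-- The shape of the weight enumerator of `C_D` when the codewords `c(z)`, `z ≠ 0`, have three
nonzero weights, each of which is attained. -/
theorem enumerator_of_three_weights [Fintype F] (D : Finset (F × F)) {w₁ w₂ w₃ : ℕ}
    (h1 : w₁ ≠ 0) (h2 : w₂ ≠ 0) (h3 : w₃ ≠ 0) (h12 : w₁ ≠ w₂) (h13 : w₁ ≠ w₃) (h23 : w₂ ≠ w₃)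
    (hW : ∀ z ≠ 0, hammingNorm (codeword p D z) = w₁ ∨ hammingNorm (codeword p D z) = w₂ ∨
      hammingNorm (codeword p D z) = w₃)
    (he1 : ∃ z, hammingNorm (codeword p D z) = w₁) (he2 : ∃ z, hammingNorm (codeword p D z) = w₂)
    (he3 : ∃ z, hammingNorm (codeword p D z) = w₃) :
    Function.Injective (codeword p D) ∧ A (code p D) 0 = 1 ∧ IsWeightCode 3 (code p D) ∧
    (∀ i, i ≠ 0 → i ≠ w₁ → i ≠ w₂ → i ≠ w₃ → A (code p D) i = 0) ∧
    Fintype.card F ^ 2 =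
      1 + A (code p D) w₁ + A (code p D) w₂ + A (code p D) w₃ := by
  classical
  have hW0 : hammingNorm (codeword p D 0) = 0 := by simp
  have hz : ∀ z, hammingNorm (codeword p D z) = 0 → z = 0 := fun z hz => by
    by_contra hz0
    rcases hW z hz0 with h | h | h <;> omega
  have hinj : Function.Injective (codeword p D) := by
    rw [injective_iff_map_eq_zero]
    exact fun z h => hz z (by simp [h])
  have hA := A_code_eq _ hinj
  have hA0 : A (code p D) 0 = 1 := by
    rw [hA, Nat.card_eq_one_iff_unique]
    exact ⟨⟨fun a b => Subtype.ext ((hz _ a.2).trans (hz _ b.2).symm)⟩, ⟨0, hW0⟩⟩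
  have hAother : ∀ i, i ≠ 0 → i ≠ w₁ → i ≠ w₂ → i ≠ w₃ → A (code p D) i = 0 := by
    rintro i i0 i1 i2 i3
    rw [hA, Nat.card_eq_zero]
    refine Or.inl ⟨?_⟩
    rintro ⟨z, rfl⟩
    rcases hW z (by rintro rfl; exact i0 hW0) with h | h | h
    exacts [i1 h, i2 h, i3 h]
  have hne : ∀ i, (∃ z, hammingNorm (codeword p D z) = i) →
      i ≤ Fintype.card D ∧ A (code p D) i ≠ 0 := by
    rintro i ⟨z, hz⟩
    have : Nonempty {z // hammingNorm (codeword p D z) = i} := ⟨⟨z, hz⟩⟩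
    exact ⟨hz ▸ hammingNorm_le_card_fintype, by rw [hA]; exact Nat.card_pos.ne'⟩
  refine ⟨hinj, hA0, ?_, hAother, ?_⟩
  · rw [IsWeightCode, Set.ncard_eq_three]
    refine ⟨w₁, w₂, w₃, h12, h13, h23, Set.ext fun i => ⟨?_, ?_⟩⟩
    · rintro ⟨i1, -, i2⟩
      by_contra h
      simp only [Set.mem_insert_iff, Set.mem_singleton_iff, not_or] at h
      exact i2 (hAother i (by omega) h.1 h.2.1 h.2.2)
    · rintro (rfl | rfl | rfl)
      exacts [⟨Nat.one_le_iff_ne_zero.2 h1, hne _ he1⟩, ⟨Nat.one_le_iff_ne_zero.2 h2, hne _ he2⟩,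
        ⟨Nat.one_le_iff_ne_zero.2 h3, hne _ he3⟩]
  · have hs := Finset.card_eq_sum_card_fiberwise (f := fun z => hammingNorm (codeword p D z))
      (s := Finset.univ) (t := {0, w₁, w₂, w₃}) (by
        intro z _
        by_cases hz : z = 0
        · simp [hz]
        · rcases hW z hz with h | h | h <;> simp [h])
    have hfib : ∀ i, (Finset.univ.filter fun z => hammingNorm (codeword p D z) = i).card =
        A (code p D) i := by
      intro i
      rw [hA, ← Fintype.card_subtype, Nat.card_eq_fintype_card]
    simp only [hfib] at hs
    rw [Finset.sum_insert (by simp; omega), Finset.sum_insert (by simp; omega),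
      Finset.sum_insert (by simp; omega), Finset.sum_singleton, hA0, Finset.card_univ,
      Fintype.card_prod, ← sq] at hs
    omega

end Enumerator

end LinCode

/-! ### Parameters and the weight distribution -/

open LinCode in
theorem theorem4 (p m u v s : ℕ) [Fact p.Prime] (hp : Odd p) (hm : 0 < m) (hu : 0 < u)
    (hv : v = Nat.gcd m u) (hs : m = 2 * s) (hmv : m / v ≡ 0 [MOD 4])
    (F : Type*) [Field F] [Fintype F] [DecidableEq F] [Algebra (ZMod p) F]
    (hF : Fintype.card F = p ^ m) :
    LinCode.IsCode (LinCode.code p (LinCode.D₁ p F u)) (p ^ (2 * m - 1) - 1) (2 * m) ∧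
    LinCode.IsWeightCode 3 (LinCode.code p (LinCode.D₁ p F u)) ∧
    ∃ w₁ w₂ w₃ : ℕ,
      (w₁ : ℚ) = (p - 1) * p ^ (2 * m - 2) ∧
      (w₂ : ℚ) = (p - 1) * p ^ (2 * m - 2) * (1 + 1 / p ^ (s - v)) ∧
      (w₃ : ℚ) = (p - 1) * p ^ (2 * m - 2) * (1 - 1 / ((p - 1) * p ^ (s - v))) ∧
      LinCode.A (LinCode.code p (LinCode.D₁ p F u)) 0 = 1 ∧
      (LinCode.A (LinCode.code p (LinCode.D₁ p F u)) w₁ : ℚ) =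
        p ^ (2 * m) - 1 - (p - 1) * p ^ (m - 2 * v) ∧
      (LinCode.A (LinCode.code p (LinCode.D₁ p F u)) w₂ : ℚ) =
        (p - 1) * (p ^ (m - 2 * v - 1) - p ^ (s - v) + p ^ (s - v - 1)) ∧
      (LinCode.A (LinCode.code p (LinCode.D₁ p F u)) w₃ : ℚ) =
        (p - 1) * (p ^ (s - v) + 1) * (p ^ (s - v) - p ^ (s - v - 1)) ∧
      ∀ i : ℕ, i ≠ 0 → i ≠ w₁ → i ≠ w₂ → i ≠ w₃ →
        LinCode.A (LinCode.code p (LinCode.D₁ p F u)) i = 0 := by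
  have hpp : p.Prime := Fact.out
  have hv0 : 0 < v := hv ▸ Nat.gcd_pos_of_pos_left _ hm
  obtain ⟨k, hk⟩ : v ∣ m := hv ▸ Nat.gcd_dvd_left _ _
  obtain ⟨w, huw⟩ : v ∣ u := hv ▸ Nat.gcd_dvd_right _ _
  rw [hk, Nat.mul_div_cancel_left _ hv0] at hmv
  obtain ⟨n, rfl⟩ := (Nat.modEq_zero_iff_dvd).1 hmv
  have hn : 0 < n := Nat.pos_of_ne_zero (by rintro rfl; simp at hk; omega)
  have hmn : m = 4 * v * n := by rw [hk]; ring
  -- Since gcd(m,u) = v, the cofactors 4n and w are coprime.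
  have hw : Odd w := by
    have h1 : v * Nat.gcd (4 * n) w = v * 1 := by
      rw [← Nat.gcd_mul_left, ← hk, ← huw, mul_one, hv]
    have h2 : Nat.Coprime (4 * n) w := Nat.eq_of_mul_eq_mul_left hv0 h1
    have h3 : Nat.Coprime 2 w := h2.coprime_dvd_left ⟨2 * n, by ring⟩
    exact Nat.coprime_two_left.1 h3
  have hsn : s = 2 * v * n := by
    have : 2 * s = 2 * (2 * v * n) := by rw [← hs, hmn]; ring
    omega
  have hvs : v < s := by
    rw [hsn]; nlinarith
  obtain ⟨e, he⟩ : ∃ e, s = v + e + 1 := ⟨s - v - 1, by omega⟩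
  have hFc : Nat.card F = p ^ m := by rw [Nat.card_eq_fintype_card, hF]
  have hp3 : 3 ≤ p := by
    have := hpp.two_le
    rcases hp with ⟨j, hj⟩
    omega
  -- With T = p^(2v) and Y = p^(s-v-1), every power of p in the statement, apart from p^(2m) and the
  -- length, becomes a monomial in p, T, Y.
  obtain ⟨T, hT⟩ : ∃ T, T = p ^ (2 * v) := ⟨_, rfl⟩
  obtain ⟨Y, hY⟩ : ∃ Y, Y = p ^ e := ⟨_, rfl⟩
  have hT0 : 0 < T := hT ▸ Nat.pow_pos hpp.pos
  have hY0 : 0 < Y := hY ▸ Nat.pow_pos hpp.pos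
  have hq : p ^ m = T * p ^ 2 * Y ^ 2 := by
    rw [hT, hY, hs, he, ← pow_mul, ← pow_add, ← pow_add]; congr 1; ring
  have hP : p ^ (2 * v * n + v) = T * p * Y := by
    rw [hT, hY, ← hsn, he, ← pow_succ, ← pow_add]; congr 1; ring
  have hX : p ^ (s - v) = p * Y := by
    rw [hY, ← pow_succ']; congr 1; omega
  have hX1 : p ^ (s - v - 1) = Y := by rw [hY]; congr 1; omega
  have hM : p ^ (m - 2 * v) = p ^ 2 * Y ^ 2 := by
    rw [hY, ← pow_mul, ← pow_add]; congr 1; omega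
  have hM1 : p ^ (m - 2 * v - 1) = p * Y ^ 2 := by
    rw [hY, ← pow_mul, ← pow_succ']; congr 1; omega
  have h2m : p ^ (2 * m) = (p ^ m) ^ 2 := by rw [← pow_mul, mul_comm]
  have hG : p ^ (2 * m - 2) = T ^ 2 * p ^ 2 * Y ^ 4 := by
    have : p ^ 2 * p ^ (2 * m - 2) = p ^ 2 * (T ^ 2 * p ^ 2 * Y ^ 4) := by
      rw [← pow_add, show 2 + (2 * m - 2) = 2 * m by omega, h2m, hq]; ring
    exact Nat.eq_of_mul_eq_mul_left (Nat.pow_pos hpp.pos) this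
  obtain ⟨r, hr⟩ : ∃ r, p = r + 1 := ⟨p - 1, by omega⟩
  -- E = p^(2m-2)/p^(s-v) is the unit of deviation: w₂ = w₁ + (p-1)E and w₃ = w₁ - E. The bound E <
  -- w₁ below makes the natural subtraction exact.
  let E : ℕ := T ^ 2 * p * Y ^ 3
  have hE0 : 0 < E := by positivity
  have hEG : p ^ (2 * m - 2) = p * Y * E := by rw [hG]; ring
  have hpY : 3 ≤ p * Y := by nlinarith
  let w₁ := (p - 1) * (p * Y * E)
  let w₂ := (p - 1) * (p * Y * E + E)
  let w₃ := (p - 1) * (p * Y * E) - E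
  have hr2 : 2 ≤ r := by omega
  have hEw : E < w₁ := by
    have : 3 * E ≤ p * Y * E := Nat.mul_le_mul_right _ hpY
    have : 2 * (p * Y * E) ≤ w₁ := Nat.mul_le_mul_right _ (by omega)
    omega
  have hw3 : w₃ + E = w₁ := Nat.sub_add_cancel hEw.le
  have hw2 : w₂ = w₁ + r * E := by simp only [w₂, w₁, hr]; simp; ring
  have hrE : 0 < r * E := by positivity
  let W : F × F → ℕ := fun z => hammingNorm (codeword p (D₁ p F u) z)
  have hp2 : ((p : ℤ) ^ 2) ≠ 0 := pow_ne_zero _ (by exact_mod_cast hpp.ne_zero)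
  have hqZ : (p : ℤ) ^ m = T * p ^ 2 * Y ^ 2 := by exact_mod_cast hq
  have hPZ : (p : ℤ) ^ (2 * v * n + v) = T * p * Y := by exact_mod_cast hP
  have hw1Z : (w₁ : ℤ) = (p - 1) * (p * Y * (T ^ 2 * p * Y ^ 3)) := by
    simp only [w₁, E, hr]; push_cast; simp
  have hEZ : (E : ℤ) = T ^ 2 * p * Y ^ 3 := by simp only [E]; push_cast; rfl
  have hw3Z : (w₃ : ℤ) + E = w₁ := by exact_mod_cast hw3
  have hw2Z : (w₂ : ℤ) = w₁ + (p - 1) * E := by rw [hw2, hr]; push_cast; ring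
  have hW2 : ∀ z, Represented p u (· = 0) z → W z = w₂ := by
    intro z hz
    have := weight_of_represented_zero hp hv0 hn hFc hmn huw hw hv.symm z hz
    rw [hqZ, hPZ] at this
    zify
    apply mul_left_cancel₀ hp2
    rw [this, hw2Z, hw1Z, hEZ]
    ring
  have hW3 : ∀ z, Represented p u (· ≠ 0) z → W z = w₃ := by
    intro z hz
    have := weight_of_represented_ne_zero hp hv0 hn hFc hmn huw hw hv.symm z hz
    rw [hqZ, hPZ] at this
    zify
    apply mul_left_cancel₀ hp2
    rw [this, eq_sub_of_add_eq hw3Z, hw1Z, hEZ]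
    ring
  have hW1 : ∀ z, z ≠ 0 → ¬ Represented p u (· = 0) z → ¬ Represented p u (· ≠ 0) z →
      W z = w₁ := by
    intro z hz h0 h1
    have := weight_of_not_represented (u := u) hp z hz h0 h1
    rw [hFc] at this
    push_cast at this
    rw [hqZ] at this
    zify
    apply mul_left_cancel₀ hp2
    rw [this, hw1Z]
    ring
  have hW0 : W 0 = 0 := by simp [W]
  have hWr : ∀ z, z ≠ 0 → W z = w₁ ∨ W z = w₂ ∨ W z = w₃ := fun z hz => by
    by_cases h0 : Represented p u (· = 0) z
    · exact Or.inr (Or.inl (hW2 z h0))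
    by_cases h1 : Represented p u (· ≠ 0) z
    · exact Or.inr (Or.inr (hW3 z h1))
    exact Or.inl (hW1 z hz h0 h1)
  -- The three weights are distinct and nonzero, so the weight of z determines its class.
  have hR2 : ∀ z, W z = w₂ ↔ Represented p u (· = 0) z := by
    refine fun z => ⟨fun h => ?_, hW2 z⟩
    by_contra h0
    by_cases hz : z = 0
    · rw [hz, hW0] at h; omega
    by_cases h1 : Represented p u (· ≠ 0) z
    · have := hW3 z h1; omega
    · have := hW1 z hz h0 h1; omega
  have hR3 : ∀ z, W z = w₃ ↔ Represented p u (· ≠ 0) z := by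
    refine fun z => ⟨fun h => ?_, hW3 z⟩
    by_contra h1
    by_cases hz : z = 0
    · rw [hz, hW0] at h; omega
    by_cases h0 : Represented p u (· = 0) z
    · have := hW2 z h0; omega
    · have := hW1 z hz h0 h1; omega
  have hker := card_ker_goldPolar (F := F) hp hv0 hn hFc hmn huw hw hv.symm
  obtain ⟨hZ, hN⟩ := card_levels_goldForm (F := F) hp hv0 hn hFc hmn huw hw hv.symm
  -- For b = 0 the functional is B(0,·), with Q(0) = 0. For w₃ a vector with Q(x) = 1 serves, and
  -- for w₁ the pair (0,1), whose first entry is not a nonzero scalar.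
  have hW2e : ∃ z, W z = w₂ :=
    ⟨(1, 0), hW2 _ ⟨1, one_ne_zero, (map_one _).symm, 0, by simp, by simp [goldForm]⟩⟩
  have hW3e : ∃ z, W z = w₃ := by
    have hN0 : Nat.card {x : F // goldForm p u x = 1} ≠ 0 := by
      intro h
      rw [h, Nat.cast_zero, mul_zero] at hN
      have : (0 : ℤ) < p ^ m + p ^ (2 * v * n + v) := by
        have := hpp.pos
        positivity
      omega
    obtain ⟨x, hx⟩ := (Nat.card_ne_zero.1 hN0).1
    refine ⟨(1, (traceDual p).symm (goldPolar p u x)), hW3 _ ⟨1, one_ne_zero, (map_one _).symm, x,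
      by simp, by simp [hx]⟩⟩
  have hW1e : ∃ z, W z = w₁ := by
    have hrep : ∀ S, ¬ Represented p u S ((0, 1) : F × F) := by
      rintro S ⟨α, hα, h, -⟩
      exact hα ((map_eq_zero _).1 h.symm)
    exact ⟨(0, 1), hW1 _ (by simp) (hrep _) (hrep _)⟩
  obtain ⟨hinj, hA0, hthree, hAother, htot⟩ := enumerator_of_three_weights (D₁ p F u)
    (by omega : w₁ ≠ 0) (by omega : w₂ ≠ 0) (by omega : w₃ ≠ 0) (by omega) (by omega) (by omega)
    hWr hW1e hW2e hW3e
  have hA := A_code_eq _ hinj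
  have hcompl : Nat.card {x : F // goldForm p u x = 0} + Nat.card {x : F // goldForm p u x ≠ 0} =
      Nat.card F := by
    simp only [Nat.card_eq_fintype_card, Fintype.card_subtype]
    exact Finset.card_filter_add_card_filter_not _
  have hA2 : T * A (code p (D₁ p F u)) w₂ = (p - 1) * Nat.card {x : F // goldForm p u x = 0} := by
    rw [← card_represented (F := F) hp (· = 0), hker, hA, hT]
    congr 1
    exact Nat.card_congr (Equiv.subtypeEquivRight hR2)
  have hA3 : T * A (code p (D₁ p F u)) w₃ = (p - 1) * Nat.card {x : F // goldForm p u x ≠ 0} := by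
    rw [← card_represented (F := F) hp (· ≠ 0), hker, hA, hT]
    congr 1
    exact Nat.card_congr (Equiv.subtypeEquivRight hR3)
  rw [hFc] at hcompl
  generalize Nat.card {x : F // goldForm p u x = 0} = Z at *
  generalize Nat.card {x : F // goldForm p u x ≠ 0} = N' at *
  have hpQ : (p : ℚ) ≠ 0 := by exact_mod_cast hpp.ne_zero
  have hTQ : (T : ℚ) ≠ 0 := by exact_mod_cast hT0.ne'
  have hp1Q : (p : ℚ) - 1 ≠ 0 := by rw [hr]; push_cast; simp; omega
  have hqQ : (p : ℚ) ^ m = T * p ^ 2 * Y ^ 2 := by exact_mod_cast hq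
  have hXQ : (p : ℚ) ^ (s - v) = p * Y := by exact_mod_cast hX
  have hX1Q : (p : ℚ) ^ (s - v - 1) = Y := by exact_mod_cast hX1
  have hMQ : (p : ℚ) ^ (m - 2 * v) = p ^ 2 * Y ^ 2 := by exact_mod_cast hM
  have hM1Q : (p : ℚ) ^ (m - 2 * v - 1) = p * Y ^ 2 := by exact_mod_cast hM1
  have hGQ : (p : ℚ) ^ (2 * m - 2) = p * Y * E := by exact_mod_cast hEG
  have hpc : ((p - 1 : ℕ) : ℚ) = p - 1 := by rw [hr]; simp
  have hw1Q : (w₁ : ℚ) = (p - 1) * (p * Y * E) := by simp only [w₁]; push_cast [hpc]; rfl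
  have hw3Q : (w₃ : ℚ) + E = w₁ := by exact_mod_cast hw3
  have hw2Q : (w₂ : ℚ) = (p - 1) * (p * Y * E + E) := by simp only [w₂]; push_cast [hpc]; rfl
  have hZQ : (p : ℚ) * Z = T * p ^ 2 * Y ^ 2 - (p - 1) * (T * p * Y) := by
    rw [hqZ, hPZ] at hZ; exact_mod_cast hZ
  have hcQ : (Z : ℚ) + N' = T * p ^ 2 * Y ^ 2 := by rw [← hqQ]; exact_mod_cast hcompl
  have hA2Q : (A (code p (D₁ p F u)) w₂ : ℚ) = (p - 1) * (p * Y ^ 2 - p * Y + Y) := by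
    have : (T : ℚ) * A (code p (D₁ p F u)) w₂ = (p - 1) * Z := by rw [← hpc]; exact_mod_cast hA2
    apply mul_left_cancel₀ hTQ
    apply mul_left_cancel₀ hpQ
    linear_combination (p : ℚ) * this + ((p : ℚ) - 1) * hZQ
  have hA3Q : (A (code p (D₁ p F u)) w₃ : ℚ) = (p - 1) * (p * Y + 1) * (p * Y - Y) := by
    have : (T : ℚ) * A (code p (D₁ p F u)) w₃ = (p - 1) * N' := by rw [← hpc]; exact_mod_cast hA3
    apply mul_left_cancel₀ hTQ
    apply mul_left_cancel₀ hpQ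
    linear_combination (p : ℚ) * this + ((p : ℚ) - 1) * p * hcQ - ((p : ℚ) - 1) * hZQ
  -- The other frequencies add up to (p-1)p²Y², and A_{w₁} is what remains of the p^(2m) codewords.
  have hA1Q : (A (code p (D₁ p F u)) w₁ : ℚ) =
      p ^ (2 * m) - 1 - (p - 1) * (p ^ 2 * Y ^ 2) := by
    have h1 : ((p : ℚ) ^ m) ^ 2 = 1 + A (code p (D₁ p F u)) w₁ + A (code p (D₁ p F u)) w₂ +
      A (code p (D₁ p F u)) w₃ := by
      rw [hF] at htot; exact_mod_cast htot
    rw [mul_comm 2 m, pow_mul, h1, hA2Q, hA3Q]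
    ring
  refine ⟨⟨?_, finrank_code hFc _ hinj⟩, hthree, w₁, w₂, w₃, ?_, ?_, ?_, hA0, ?_, ?_, ?_, hAother⟩
  · have h1 := card_D₁ (p := p) (F := F) (u := u)
    rw [hFc, ← sq, ← h2m, show 2 * m = (2 * m - 1) + 1 by omega, pow_succ'] at h1
    have h2 := Nat.eq_of_mul_eq_mul_left hpp.pos h1
    omega
  · rw [hGQ, hw1Q]
  · rw [hGQ, hw2Q, hXQ]
    field_simp
  · rw [hGQ, eq_sub_of_add_eq hw3Q, hw1Q, hXQ]
    field_simp
  · rw [hMQ, hA1Q]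
  · rw [hM1Q, hXQ, hX1Q, hA2Q]
  · rw [hXQ, hX1Q, hA3Q]
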